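/- Let $N$ be prime and $1\le S\le L<N$. In one fading block, a random support $\mathcal L$ takes values in the $S$-element subsets of $\{0,\dots,L-1\}$ (with arbitrary prior probabilities), the time-domain taps $h\in\mathbb C^N$ vanish off $\mathcal L$, and given $\mathcal L$ the vector of the taps $(h[l])_{l\in\mathcal L}$ is $\mathcal{CN}(0,S^{-1}I)$ and independent of the noise $v\sim\mathcal{CN}(0,I)$ in $\mathbb C^N$. Let $F$ be the $N\times N$ unitary DFT matrix, $h_f=\sqrt N Fh$ the frequency-domain channel, and $v_f=Fv$. Let $\mathcal N_p\subset\{0,\dots,N-1\}$ be a set of $P\ge S$ pilot subcarriers with pilot values $|x_p[n]|=1$, and for $\rho>0$ let the pilot observations be $y_p[n]=\sqrt\rho\,x_p[n]\,h_f[n]+v_f[n]$, $n\in\mathcal N_p$. For an $S$-element set $\mathcal L_i\subset\{0,\dots,L-1\}$ let $\hat h_{f,i}=\sqrt N F_i\,\hat h_{i}$, where $F_i$ consists of the columns $\mathcal L_i$ of $F$ and $\hat h_i\in\mathbb C^S$ is the MMSE estimate (posterior mean) of the nonzero taps given $y_p$ under the hypothesis $\mathcal L=\mathcal L_i$, and let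 $\tilde h_{f,i}=h_f-\hat h_{f,i}$. Let $\mathcal L_{\rm true}$ be a support that occurs with positive probability. Then there exists a constant $C$, independent of $\rho$, such that $$\mathbb E\{\|\tilde h_{f,i}\|^2\mid \mathcal L=\mathcal L_{\rm true}\}\le C\rho^{-1}\quad\text{for all }\rho>0$$ if and only if $\mathcal L_i=\mathcal L_{\rm true}$. -/

import Mathlib

open MeasureTheory ProbabilityTheory

namespace SparseChannel

noncomputable section

/-- The `N`-dimensional unitary discrete Fourier transform matrix. -/
def dft (N : ℕ) : Matrix (Fin N) (Fin N) ℂ :=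
  Matrix.of fun n l =>
    ((Real.sqrt N : ℝ) : ℂ)⁻¹ *
      Complex.exp (-(2 * (Real.pi : ℂ) * Complex.I * (n : ℕ) * (l : ℕ) / (N : ℂ)))

/-- The circular complex Gaussian density `CN(x; m, s I)` with mean `m` and covariance `s I`,
with respect to Lebesgue measure on `ι → ℂ`. -/
def cnDensity {ι : Type*} [Fintype ι] (m : ι → ℂ) (s : ℝ) (x : ι → ℂ) : ℝ :=
  ((Real.pi * s) ^ Fintype.card ι)⁻¹ * Real.exp (-((∑ j, ‖x j - m j‖ ^ 2) / s))

/-- The circular complex Gaussian law `CN(m, s I)`. -/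
def cnLaw {ι : Type*} [Fintype ι] (m : ι → ℂ) (s : ℝ) : Measure (ι → ℂ) :=
  (volume : Measure (ι → ℂ)).withDensity fun x => ENNReal.ofReal (cnDensity m s x)

/-- The possible supports: the `S`-element subsets of `{0, …, L - 1}`, inside `{0, …, N - 1}`. -/
def IsSupport {N : ℕ} (L S : ℕ) (A : Finset (Fin N)) : Prop :=
  A.card = S ∧ ∀ l ∈ A, (l : ℕ) < L

/-- One fading block of the `S`-sparse length-`L` channel with block length `N`, on a probability
space `(Ω, μ)`: a random support, the time-domain taps `h` (zero padded to length `N`) and the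
time-domain noise `v`. Given that the support is `T`, the taps on `T` are `CN(0, S⁻¹ I)`, the
noise is `CN(0, I)`, and taps and noise are independent. The prior law of the support is
arbitrary. -/
structure Block {Ω : Type*} [MeasurableSpace Ω] (μ : Measure Ω) (N L S : ℕ) where
  support : Ω → Finset (Fin N)
  taps : Ω → Fin N → ℂ
  noise : Ω → Fin N → ℂ
  measurableSet_support : ∀ T : Finset (Fin N), MeasurableSet {ω | support ω = T}
  measurable_taps : Measurable taps
  measurable_noise : Measurable noise
  isSupport : ∀ ω, IsSupport L S (support ω)
  taps_eq_zero : ∀ ω, ∀ l ∉ support ω, taps ω l = 0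
  law_taps : ∀ T : Finset (Fin N), μ {ω | support ω = T} ≠ 0 →
    (ProbabilityTheory.cond μ {ω | support ω = T}).map (fun ω (l : T) => taps ω l) =
      cnLaw (0 : T → ℂ) (S : ℝ)⁻¹
  law_noise : ∀ T : Finset (Fin N), μ {ω | support ω = T} ≠ 0 →
    (ProbabilityTheory.cond μ {ω | support ω = T}).map noise = cnLaw (0 : Fin N → ℂ) 1
  indep : ∀ T : Finset (Fin N), μ {ω | support ω = T} ≠ 0 →
    IndepFun taps noise (ProbabilityTheory.cond μ {ω | support ω = T})

/-- The frequency-domain channel `√N F h` of the time-domain taps `h`. -/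
def freqChannel {N : ℕ} (h : Fin N → ℂ) : Fin N → ℂ :=
  fun n => ((Real.sqrt N : ℝ) : ℂ) * (dft N).mulVec h n

/-- The noiseless pilot observations `√(ρN) Diag(x) F_{p,A} g` produced by taps `g` on the
support `A`, where `F_{p,A}` has rows `Np` and columns `A` of the DFT matrix. -/
def pilotMean {N : ℕ} (ρ : ℝ) (Np : Finset (Fin N)) (x : Np → ℂ) (A : Finset (Fin N))
    (g : A → ℂ) : Np → ℂ :=
  fun n => ((Real.sqrt (ρ * N) : ℝ) : ℂ) * x n *
    ((dft N).submatrix (fun i : Np => (i : Fin N)) (fun a : A => (a : Fin N))).mulVec g n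

/-- The joint density of taps `g` and pilot observations `y` under the hypothesis that the
support is `A`. -/
def jointDensity {N : ℕ} (S : ℕ) (ρ : ℝ) (Np : Finset (Fin N)) (x : Np → ℂ)
    (A : Finset (Fin N)) (y : Np → ℂ) (g : A → ℂ) : ℝ :=
  cnDensity (pilotMean ρ Np x A g) 1 y * cnDensity (0 : A → ℂ) (S : ℝ)⁻¹ g

/-- The MMSE estimate of the nonzero taps from the pilot observations `y` under the hypothesis
that the support is `A`: the posterior mean given `y`, by Bayes' rule. -/
def mmseTaps {N : ℕ} (S : ℕ) (ρ : ℝ) (Np : Finset (Fin N)) (x : Np → ℂ)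
    (A : Finset (Fin N)) (y : Np → ℂ) : A → ℂ :=
  fun a => (∫ g : A → ℂ, (jointDensity S ρ Np x A y g : ℂ) * g a) /
    ((∫ g : A → ℂ, jointDensity S ρ Np x A y g : ℝ) : ℂ)

/-- The support-hypothesized MMSE estimate `√N F_A ĝ` of the frequency-domain channel, where
`F_A` consists of the columns `A` of the DFT matrix and `ĝ` is the estimate of the taps. -/
def mmseFreqChannel {N : ℕ} (S : ℕ) (ρ : ℝ) (Np : Finset (Fin N)) (x : Np → ℂ)
    (A : Finset (Fin N)) (y : Np → ℂ) : Fin N → ℂ :=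
  fun n => ((Real.sqrt N : ℝ) : ℂ) *
    ((dft N).submatrix id (fun a : A => (a : Fin N))).mulVec (mmseTaps S ρ Np x A y) n

namespace Block

variable {Ω : Type*} [MeasurableSpace Ω] {μ : Measure Ω} {N L S : ℕ}

/-- The pilot observations: on each pilot subcarrier `n ∈ Np`, the received frequency-domain
sample `√ρ x[n] h_f[n] + v_f[n]` with `h_f = √N F h` and `v_f = F v`. -/
def pilotObs (B : Block μ N L S) (ρ : ℝ) (Np : Finset (Fin N)) (x : Np → ℂ) (ω : Ω) : Np → ℂ :=
  fun n => ((Real.sqrt ρ : ℝ) : ℂ) * x n * freqChannel (B.taps ω) n +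
    (dft N).mulVec (B.noise ω) n

/-- The error of the estimate of the frequency-domain channel under support hypothesis `A`. -/
def estError (B : Block μ N L S) (ρ : ℝ) (Np : Finset (Fin N)) (x : Np → ℂ)
    (A : Finset (Fin N)) (ω : Ω) : Fin N → ℂ :=
  fun n => freqChannel (B.taps ω) n - mmseFreqChannel S ρ Np x A (B.pilotObs ρ Np x ω) n

/-- The mean squared Euclidean norm of the estimation error under support hypothesis `A`, given
that the true support is `T`, as an element of `[0, ∞]`. -/
def meanSqError (B : Block μ N L S) (ρ : ℝ) (Np : Finset (Fin N)) (x : Np → ℂ)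
    (A T : Finset (Fin N)) : ENNReal :=
  ∫⁻ ω, ∑ n, ‖B.estError ρ Np x A ω n‖ₑ ^ 2 ∂(ProbabilityTheory.cond μ {ω | B.support ω = T})

end Block

end

end SparseChannel

/-! Since the DFT is unitary, the frequency-domain error is `N` times the squared distance between
the taps and the zero-padded tap estimate (`sum_norm_sq_estError`), so the question lives in the tap
domain.

If `A ≠ T`, equal cardinalities give a tap in `T` outside `A`. Its estimate is zero, so the error is
at least the second moment of that tap, a positive number independent of `ρ`; no bound `C / ρ`
survives `ρ → ∞`.

If `A = T`, the posterior mean solves the normal equations of ridge regression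
(`gaussian_posterior_mean`). Pairing these with the error bounds it by `λ⁻¹ ρ⁻¹ (S ‖g‖² + ‖w‖²)`
(`ridge_error_le`), whose expectation is finite. Here `λ > 0` is a lower bound for the pilot matrix,
which must therefore be injective for every choice of pilots and support. For prime `N` this is
Chebotarëv's theorem on the minors of the Fourier matrix.

Chebotarëv's theorem is proved by descent in `ℤ[ζ]`. A kernel vector of a minor is the coefficient
vector of a polynomial with `r` terms vanishing at `r` distinct powers of `ζ`. Modulo `ζ - 1` these
roots merge into an `r`-fold root at `1`, which in characteristic `p` forces the coefficients to
vanish. The vector is thus divisible by `ζ - 1`, and dividing repeats the argument. -/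

/-! ### Chebotarëv's theorem on minors of the Fourier matrix -/

section Chebotarev

open Polynomial

/-- Applying `X d/dX` `k` times to a polynomial with a root at `1` of order more than `k` and
evaluating at `1` gives zero: the power moments of the coefficients vanish. -/
theorem sum_mul_pow_eq_zero_of_X_sub_one_pow_dvd {k : Type*} [CommRing k] {n : ℕ} {r : ℕ}
    (c : Fin r → k) (a : Fin r → ℕ) (h : (X - 1) ^ n ∣ ∑ j, C (c j) * (X : k[X]) ^ a j)
    {i : ℕ} (hi : i < n) : ∑ j, c j * (a j : k) ^ i = 0 := by
  induction i generalizing c n with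
  | zero =>
    obtain ⟨q, hq⟩ := h
    have := congrArg (eval 1) hq
    simpa [eval_finsetSum, (Nat.pos_of_ne_zero (by lia) : 0 < n).ne'] using this
  | succ i ih =>
    obtain ⟨n, rfl⟩ : ∃ m, n = m + 1 := ⟨n - 1, by lia⟩
    have hd : (X - 1) ^ n ∣ ∑ j, C (c j * (a j : k)) * (X : k[X]) ^ a j := by
      obtain ⟨q, hq⟩ := h
      have h1 := congrArg (fun p => X * derivative p) hq
      simp only [derivative_sum, derivative_mul, derivative_C, zero_mul, zero_add,
        derivative_X, mul_one, derivative_pow, Finset.mul_sum] at h1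
      have h2 : ∑ j, C (c j * (a j : k)) * (X : k[X]) ^ a j =
          ∑ j, X * (C (c j) * (C (a j : k) * X ^ (a j - 1))) := by
        refine Finset.sum_congr rfl fun j _ => ?_
        -- For `a j = 0` the truncated exponent `a j - 1` is harmless, since its coefficient is
        -- zero.
        rcases Nat.eq_zero_or_pos (a j) with h0 | h0
        · simp [h0]
        · obtain ⟨b, hb⟩ : ∃ b, a j = b + 1 := ⟨a j - 1, by lia⟩
          rw [hb]
          simp only [Nat.add_sub_cancel, C_mul]
          ring
      rw [h2, h1]
      refine Dvd.dvd.mul_left (dvd_add ?_ ?_) _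
      · refine Dvd.dvd.mul_right (Dvd.dvd.mul_right ?_ _) _
        simp
      · exact Dvd.dvd.mul_right (pow_dvd_pow _ (by lia)) _
    have := ih (n := n) (fun j => c j * (a j : k)) hd (by lia)
    rw [← this]
    exact Finset.sum_congr rfl fun j _ => by ring

/-- A polynomial of degree less than `p` over a domain of characteristic `p` with at most `r`
terms and with a root at `1` of order at least `r` is zero. -/
theorem eq_zero_of_X_sub_one_pow_dvd {k : Type*} [CommRing k] [IsDomain k] (p : ℕ) [CharP k p]
    {r : ℕ} (c : Fin r → k) (a : Fin r → ℕ) (ha : Function.Injective a) (hap : ∀ j, a j < p)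
    (h : (X - 1) ^ r ∣ ∑ j, C (c j) * (X : k[X]) ^ a j) : c = 0 := by
  -- The vanishing moments form a Vandermonde system with nodes `a j`, distinct in `k` because they
  -- are distinct naturals below `p`.
  refine Matrix.eq_zero_of_forall_pow_sum_mul_pow_eq_zero (f := fun j => (a j : k)) ?_
    fun i => sum_mul_pow_eq_zero_of_X_sub_one_pow_dvd c a h i.2
  intro i j hij
  exact ha (Nat.ModEq.eq_of_lt_of_lt ((CharP.natCast_eq_natCast k p).1 hij) (hap i) (hap j))

/-- A polynomial over a domain vanishing at distinct points is divisible by the product of the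
corresponding linear factors. -/
theorem prod_X_sub_C_dvd_of_forall_isRoot {R ι : Type*} [CommRing R] [IsDomain R] (s : Finset ι)
    (z : ι → R) (hz : Set.InjOn z s) (f : R[X]) (hf : ∀ i ∈ s, f.IsRoot (z i)) :
    ∏ i ∈ s, (X - C (z i)) ∣ f := by
  classical
  induction s using Finset.induction_on generalizing f with
  | empty => simp
  | insert i s his ih =>
    obtain ⟨q, rfl⟩ := dvd_iff_isRoot.2 (hf i (Finset.mem_insert_self _ _))
    rw [Finset.prod_insert his]
    refine mul_dvd_mul_left _ (ih (hz.mono (by simp)) q fun j hj => ?_)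
    have h := hf j (Finset.mem_insert_of_mem hj)
    have hne : z j - z i ≠ 0 := by
      intro h0
      have := hz (by simp [hj]) (by simp) (sub_eq_zero.1 h0)
      exact his (this ▸ hj)
    simpa [IsRoot, hne] using h

/-- One descent step for the minors of a Fourier matrix: a kernel vector is divisible by `ζ - 1`. -/
theorem sub_one_dvd_of_sum_mul_pow_eq_zero {R : Type*} [CommRing R] [IsDomain R] {p : ℕ}
    [Fact p.Prime] {ζ : R} (hζ : IsPrimitiveRoot ζ p) (hprime : Prime (ζ - 1))
    (hp : ζ - 1 ∣ (p : R)) {r : ℕ} (a b : Fin r → ℕ) (ha : Function.Injective a)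
    (hb : Function.Injective b) (hap : ∀ j, a j < p) (hbp : ∀ j, b j < p) (v : Fin r → R)
    (hv : ∀ i, ∑ j, v j * ζ ^ (b i * a j) = 0) (j : Fin r) : ζ - 1 ∣ v j := by
  let I : Ideal R := Ideal.span {ζ - 1}
  have hI : I.IsPrime := (Ideal.span_singleton_prime hprime.ne_zero).2 hprime
  let π := Ideal.Quotient.mk I
  have hpi (x : R) : π x = 0 ↔ ζ - 1 ∣ x := by
    rw [Ideal.Quotient.eq_zero_iff_mem, Ideal.mem_span_singleton]
  have hcast : (p : R ⧸ I) = 0 := by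
    have := (hpi p).2 hp
    simpa using this
  have : CharP (R ⧸ I) p := by
    have hd : ringChar (R ⧸ I) ∣ p := ringChar.dvd hcast
    rcases (Nat.dvd_prime (Fact.out : p.Prime)).1 hd with h | h
    · have h1 : ((1 : ℕ) : R ⧸ I) = 0 := by rw [← h]; exact ringChar.Nat.cast_ringChar
      simp at h1
    · rw [← h]; exact ringChar.charP _
  have hζ1 : π ζ = 1 := by
    rw [← sub_eq_zero, ← map_one π, ← map_sub, hpi]
  have hdvd : ∏ i, (X - C (ζ ^ b i)) ∣ ∑ j, C (v j) * (X : R[X]) ^ a j := by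
    refine prod_X_sub_C_dvd_of_forall_isRoot _ _ ?_ _ fun i _ => ?_
    · intro i _ j _ hij
      exact hb (hζ.pow_inj (hbp i) (hbp j) hij)
    · rw [IsRoot, eval_finsetSum, ← hv i]
      exact Finset.sum_congr rfl fun j _ => by simp [pow_mul]
  -- Modulo `ζ - 1` every power of `ζ` becomes `1`, so the product becomes `(X - 1) ^ r`.
  have hmap := map_dvd (mapRingHom π) hdvd
  simp only [map_prod, map_sum, map_mul, map_pow, map_sub, coe_mapRingHom, map_X, map_C, hζ1,
    one_pow, map_one, Finset.prod_const, Finset.card_univ, Fintype.card_fin] at hmap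
  have h0 := eq_zero_of_X_sub_one_pow_dvd p (fun j => π (v j)) a ha hap
    (by simpa using hmap)
  exact (hpi _).1 (congrFun h0 j)

/-- Infinite descent: a kernel vector divided by `ζ - 1` is again a kernel vector, so its entries
are divisible by every power of `ζ - 1`, which a nonzero element of a `WfDvdMonoid` cannot be. -/
theorem eq_zero_of_sum_mul_pow_eq_zero {R : Type*} [CommRing R] [IsDomain R] [WfDvdMonoid R]
    {p : ℕ} [Fact p.Prime] {ζ : R} (hζ : IsPrimitiveRoot ζ p) (hprime : Prime (ζ - 1))
    (hp : ζ - 1 ∣ (p : R)) {r : ℕ} (a b : Fin r → ℕ) (ha : Function.Injective a)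
    (hb : Function.Injective b) (hap : ∀ j, a j < p) (hbp : ∀ j, b j < p) (v : Fin r → R)
    (hv : ∀ i, ∑ j, v j * ζ ^ (b i * a j) = 0) : v = 0 := by
  have key (k : ℕ) : ∀ v : Fin r → R, (∀ i, ∑ j, v j * ζ ^ (b i * a j) = 0) →
      ∀ j, (ζ - 1) ^ k ∣ v j := by
    induction k with
    | zero => simp
    | succ k ih =>
      intro v hv j
      choose w hw using sub_one_dvd_of_sum_mul_pow_eq_zero hζ hprime hp a b ha hb hap hbp v hv
      rw [hw, pow_succ']
      refine mul_dvd_mul_left _ (ih w (fun i => ?_) j)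
      have h := hv i
      simp only [hw, mul_assoc, ← Finset.mul_sum] at h
      exact (mul_eq_zero.1 h).resolve_left hprime.ne_zero
  funext j
  by_contra hj
  obtain ⟨n, hn⟩ := FiniteMultiplicity.of_not_isUnit hprime.not_isUnit hj
  exact hn (key (n + 1) v hv j)

/-- **Chebotarëv's theorem on roots of unity**: every minor of the Fourier matrix of prime order
is nonzero, stated for kernel vectors. -/
theorem eq_zero_of_forall_sum_mul_primitiveRoot_pow_eq_zero {p : ℕ} [Fact p.Prime] {z : ℂ}
    (hz : IsPrimitiveRoot z p) {r : ℕ} (a b : Fin r → ℕ) (ha : Function.Injective a)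
    (hb : Function.Injective b) (hap : ∀ j, a j < p) (hbp : ∀ j, b j < p) (v : Fin r → ℂ)
    (hv : ∀ i, ∑ j, v j * z ^ (b i * a j) = 0) : v = 0 := by
  have : NeZero ((p : ℕ) : ℚ) := ⟨Nat.cast_ne_zero.2 (Fact.out : p.Prime).ne_zero⟩
  let K := CyclotomicField p ℚ
  have : IsCyclotomicExtension {p} ℚ K := CyclotomicField.isCyclotomicExtension p ℚ
  have hζ₀ : IsPrimitiveRoot (IsCyclotomicExtension.zeta p ℚ K) p :=
    IsCyclotomicExtension.zeta_spec p ℚ K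
  -- The given root `z` is a power of the image of the standard root under any embedding; taking
  -- that power already in `K` makes `σ ζ = z`.
  let σ : K →+* ℂ := Classical.arbitrary (K →+* ℂ)
  obtain ⟨k, hk, hkz⟩ := (hζ₀.map_of_injective σ.injective).eq_pow_of_pow_eq_one hz.pow_eq_one
  let ζ : K := IsCyclotomicExtension.zeta p ℚ K ^ k
  have hσ : σ ζ = z := by simp [ζ, map_pow, hkz]
  have hζ : IsPrimitiveRoot ζ p := by
    rw [← hσ] at hz
    exact hz.of_map_of_injective σ.injective
  let M : Matrix (Fin r) (Fin r) (NumberField.RingOfIntegers K) :=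
    Matrix.of fun i j => hζ.toInteger ^ (b i * a j)
  let φ : NumberField.RingOfIntegers K →+* ℂ :=
    σ.comp (algebraMap (NumberField.RingOfIntegers K) K)
  have hφ : Function.Injective φ := σ.injective.comp
    (FaithfulSMul.algebraMap_injective (NumberField.RingOfIntegers K) K)
  have hφζ : φ hζ.toInteger = z := hσ
  -- The descent needs entries in the ring of integers, whereas `v` is complex. The determinant
  -- bridges the two: it is nonzero over the integers of `K`, and `φ` is injective.
  have hdet : M.det ≠ 0 := by
    intro h
    obtain ⟨w, hw0, hw⟩ := Matrix.exists_mulVec_eq_zero_iff.2 h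
    refine hw0 (eq_zero_of_sum_mul_pow_eq_zero (p := p) hζ.toInteger_isPrimitiveRoot
      hζ.zeta_sub_one_prime' hζ.toInteger_sub_one_dvd_prime' a b ha hb hap hbp w fun i => ?_)
    have := congrFun hw i
    simpa [M, Matrix.mulVec, dotProduct, mul_comm] using this
  have hdet' : (M.map φ).det ≠ 0 := by
    have : (M.map φ).det = φ M.det := (φ.map_det M).symm
    rw [this]
    exact fun h => hdet (hφ (by rw [h, map_zero]))
  refine Matrix.eq_zero_of_mulVec_eq_zero hdet' (funext fun i => ?_)
  have := hv i
  simpa [M, Matrix.mulVec, dotProduct, mul_comm, hφζ] using this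

end Chebotarev

/-! ### Norms of complex vectors and the discrete Fourier transform -/

theorem ofReal_sum_norm_sq {ι : Type*} [Fintype ι] (x : ι → ℂ) :
    ((∑ j, ‖x j‖ ^ 2 : ℝ) : ℂ) = star x ⬝ᵥ x := by
  simp [dotProduct, Complex.conj_mul']

theorem sum_norm_sq_eq_re {ι : Type*} [Fintype ι] (x : ι → ℂ) :
    ∑ j, ‖x j‖ ^ 2 = (star x ⬝ᵥ x).re := by
  rw [← ofReal_sum_norm_sq, Complex.ofReal_re]

namespace SparseChannel

theorem isPrimitiveRoot_exp_neg {N : ℕ} (hN : N ≠ 0) :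
    IsPrimitiveRoot (Complex.exp (-(2 * (Real.pi : ℂ) * Complex.I / (N : ℂ)))) N := by
  rw [Complex.exp_neg]
  exact (Complex.isPrimitiveRoot_exp N hN).inv

theorem dft_apply {N : ℕ} (n l : Fin N) :
    dft N n l = ((Real.sqrt N : ℝ) : ℂ)⁻¹ *
      Complex.exp (-(2 * (Real.pi : ℂ) * Complex.I / (N : ℂ))) ^ ((n : ℕ) * (l : ℕ)) := by
  rw [dft, Matrix.of_apply, ← Complex.exp_nat_mul]
  congr 2
  push_cast
  ring

theorem dft_conjTranspose_mul_self {N : ℕ} : (dft N).conjTranspose * dft N = 1 := by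
  rcases Nat.eq_zero_or_pos N with rfl | hN
  · exact Subsingleton.elim _ _
  have hz := isPrimitiveRoot_exp_neg hN.ne'
  set z := Complex.exp (-(2 * (Real.pi : ℂ) * Complex.I / (N : ℂ))) with hzdef
  have hz0 : z ≠ 0 := Complex.exp_ne_zero _
  have hnorm : ‖z‖ = 1 := hz.norm'_eq_one hN.ne'
  have hconj : (starRingEnd ℂ) z = z⁻¹ := (Complex.inv_eq_conj hnorm).symm
  have hsq : (((Real.sqrt N : ℝ) : ℂ)⁻¹) * ((Real.sqrt N : ℝ) : ℂ)⁻¹ = (N : ℂ)⁻¹ := by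
    rw [← mul_inv, ← Complex.ofReal_mul, Real.mul_self_sqrt (Nat.cast_nonneg N)]
    simp
  have hN0 : (N : ℂ) ≠ 0 := Nat.cast_ne_zero.2 hN.ne'
  ext l m
  have hterm (n : Fin N) : (dft N).conjTranspose l n * dft N n m =
      (N : ℂ)⁻¹ * (z ^ (m : ℕ) / z ^ (l : ℕ)) ^ (n : ℕ) := by
    rw [Matrix.conjTranspose_apply, dft_apply, dft_apply, ← hzdef, ← hsq]
    simp only [star_mul', RCLike.star_def, map_inv₀, Complex.conj_ofReal, map_pow, hconj]
    rw [div_pow, ← pow_mul, ← pow_mul, mul_comm (n : ℕ), mul_comm (n : ℕ), inv_pow]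
    ring
  rw [Matrix.mul_apply, Finset.sum_congr rfl fun n _ => hterm n, ← Finset.mul_sum,
    Fin.sum_univ_eq_sum_range (fun n => (z ^ (m : ℕ) / z ^ (l : ℕ)) ^ n)]
  by_cases hlm : l = m
  · subst hlm
    simp [hz0, hN0]
  · have hne : z ^ (m : ℕ) / z ^ (l : ℕ) ≠ 1 := by
      intro h
      rw [div_eq_one_iff_eq (pow_ne_zero _ hz0)] at h
      exact hlm (Fin.ext (hz.pow_inj m.2 l.2 h).symm)
    have hone : (z ^ (m : ℕ) / z ^ (l : ℕ)) ^ N = 1 := by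
      rw [div_pow, ← pow_mul, ← pow_mul, mul_comm, pow_mul, mul_comm, pow_mul, hz.pow_eq_one]
      simp
    rw [geom_sum_eq hne, hone, Matrix.one_apply_ne hlm]
    simp

/-- Parseval's identity for the unitary discrete Fourier transform. -/
theorem sum_norm_sq_dft_mulVec {N : ℕ} (u : Fin N → ℂ) :
    ∑ n, ‖(dft N).mulVec u n‖ ^ 2 = ∑ l, ‖u l‖ ^ 2 := by
  rw [sum_norm_sq_eq_re, sum_norm_sq_eq_re, Matrix.star_mulVec, Matrix.dotProduct_mulVec,
    Matrix.vecMul_vecMul, dft_conjTranspose_mul_self, Matrix.vecMul_one]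

/-- For prime `N`, a submatrix of the Fourier matrix with at least as many rows as columns has
full column rank. -/
theorem dft_submatrix_mulVec_injective {N : ℕ} (hN : N.Prime) (Np A : Finset (Fin N))
    (hcard : A.card ≤ Np.card) (g : A → ℂ)
    (hg : ((dft N).submatrix (fun i : Np => (i : Fin N)) (fun a : A => (a : Fin N))).mulVec g = 0) :
    g = 0 := by
  have : Fact N.Prime := ⟨hN⟩
  -- Discarding surplus rows leaves a square minor.
  obtain ⟨Q, hQ, hQc⟩ := Finset.exists_subset_card_eq hcard
  let a := (A.equivFin).symm
  let b := (Q.equivFinOfCardEq hQc).symm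
  have h := eq_zero_of_forall_sum_mul_primitiveRoot_pow_eq_zero (isPrimitiveRoot_exp_neg hN.ne_zero)
    (fun j => ((a j : Fin N) : ℕ)) (fun i => ((b i : Fin N) : ℕ))
    (fun i j hij => a.injective (Subtype.ext (Fin.ext hij)))
    (fun i j hij => b.injective (Subtype.ext (Fin.ext hij)))
    (fun j => (a j : Fin N).2) (fun j => (b j : Fin N).2) (fun j => g (a j)) fun i => by
      have h1 := congrFun hg ⟨b i, hQ (b i).2⟩
      have hs : ((Real.sqrt N : ℝ) : ℂ)⁻¹ ≠ 0 :=
        inv_ne_zero (Complex.ofReal_ne_zero.2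
          (Real.sqrt_ne_zero'.2 (Nat.cast_pos.2 hN.pos)))
      simp only [Matrix.mulVec, dotProduct, Matrix.submatrix_apply, dft_apply, mul_assoc,
        ← Finset.mul_sum, Pi.zero_apply, mul_eq_zero, hs, false_or] at h1
      rw [← h1, ← a.sum_comp]
      exact Finset.sum_congr rfl fun j _ => by rw [mul_assoc 2]; exact mul_comm _ _
  funext x
  simpa [a] using congrFun h (A.equivFin x)

end SparseChannel

/-! ### Gaussian integrals -/

section Gaussian

variable {ι : Type*} [Fintype ι]

theorem integrable_exp_neg_mul_sum_norm_sq {s : ℝ} (hs : 0 < s) :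
    Integrable fun x : ι → ℂ => Real.exp (-(s * ∑ j, ‖x j‖ ^ 2)) := by
  have h1 : Integrable fun z : ℂ => Real.exp (-(s * ‖z‖ ^ 2)) := by
    have h := (GaussianFourier.integrable_cexp_neg_mul_sq_norm_add (V := ℂ) (b := s)
      (by simpa using hs) 0 0).norm
    refine h.congr (Filter.Eventually.of_forall fun z => ?_)
    simp only [Complex.norm_exp]
    norm_num [← Complex.ofReal_pow, ← Complex.ofReal_mul]
  have h2 := Integrable.fintype_prod (ι := ι) (μ := fun _ => (volume : Measure ℂ))
    (f := fun _ z => Real.exp (-(s * ‖z‖ ^ 2))) fun _ => h1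
  refine h2.congr (Filter.Eventually.of_forall fun x => ?_)
  simp only
  rw [← Real.exp_sum, Finset.sum_neg_distrib, Finset.mul_sum]

theorem integrable_norm_sq_mul_exp_neg_mul_sum_norm_sq {s : ℝ} (hs : 0 < s) (a : ι) :
    Integrable fun x : ι → ℂ => ‖x a‖ ^ 2 * Real.exp (-(s * ∑ j, ‖x j‖ ^ 2)) := by
  refine ((integrable_exp_neg_mul_sum_norm_sq (ι := ι) (half_pos hs)).const_mul (2 / s)).mono'
    (by fun_prop) (Filter.Eventually.of_forall fun x => ?_)
  set t := ∑ j, ‖x j‖ ^ 2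
  have ht : ‖x a‖ ^ 2 ≤ t :=
    Finset.single_le_sum (f := fun j => ‖x j‖ ^ 2) (fun j _ => by positivity) (Finset.mem_univ a)
  -- Half of the Gaussian decay absorbs the quadratic factor.
  have h1 : t ≤ 2 / s * Real.exp (s / 2 * t) := by
    have := Real.add_one_le_exp (s / 2 * t)
    calc t = 2 / s * (s / 2 * t) := by field_simp
      _ ≤ _ := by gcongr; linarith
  rw [Real.norm_of_nonneg (by positivity)]
  calc ‖x a‖ ^ 2 * Real.exp (-(s * t))
      ≤ (2 / s * Real.exp (s / 2 * t)) * Real.exp (-(s * t)) := by gcongr; linarith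
    _ = 2 / s * Real.exp (-(s / 2 * t)) := by
      rw [mul_assoc, ← Real.exp_add]; ring_nf

theorem integrable_mul_exp_neg_mul_sum_norm_sq {s : ℝ} (hs : 0 < s) (a : ι) :
    Integrable fun x : ι → ℂ => ‖x a‖ * Real.exp (-(s * ∑ j, ‖x j‖ ^ 2)) := by
  refine ((integrable_exp_neg_mul_sum_norm_sq (ι := ι) hs).add
    (integrable_norm_sq_mul_exp_neg_mul_sum_norm_sq hs a)).mono'
    (by fun_prop) (Filter.Eventually.of_forall fun x => ?_)
  rw [Real.norm_of_nonneg (by positivity), Pi.add_apply, ← one_add_mul]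
  gcongr
  nlinarith [sq_nonneg (‖x a‖ - 1)]

/-- The mean of a density that is symmetric about `g₀` is `g₀`. -/
theorem integral_mul_div_integral_of_even {φ f : (ι → ℂ) → ℝ} {c : ℝ} {g₀ : ι → ℂ}
    (heven : ∀ u, φ (-u) = φ u) (hφ : Integrable φ) (a : ι)
    (hφa : Integrable fun u => (φ u : ℂ) * u a) (hφ0 : ∫ u, φ u ≠ 0) (hc : c ≠ 0)
    (hf : ∀ g, f g = c * φ (g - g₀)) :
    (∫ g, (f g : ℂ) * g a) / ((∫ g, f g : ℝ) : ℂ) = g₀ a := by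
  have hodd : ∫ u, (φ u : ℂ) * u a = 0 := by
    have h := integral_neg_eq_self (fun u : ι → ℂ => (φ u : ℂ) * u a) volume
    simp only [heven, Pi.neg_apply, mul_neg, integral_neg] at h
    exact self_eq_neg.1 h.symm
  have hden : ∫ g, f g = c * ∫ u, φ u := by
    simp only [hf]
    rw [integral_const_mul, integral_sub_right_eq_self φ g₀]
  have hnum : ∫ g, (f g : ℂ) * g a = c * (∫ u, φ u : ℝ) * g₀ a := by
    have h1 : ∀ g : ι → ℂ, (f g : ℂ) * g a =
        (fun u : ι → ℂ => c * ((φ u : ℂ) * u a) + c * g₀ a * (φ u : ℂ)) (g - g₀) := by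
      intro g
      simp only [hf, Pi.sub_apply]
      push_cast
      ring
    have hφ' : Integrable fun u => (φ u : ℂ) := hφ.ofReal
    simp only [h1]
    rw [integral_sub_right_eq_self (fun u : ι → ℂ => c * ((φ u : ℂ) * u a) + c * g₀ a * (φ u : ℂ))
      g₀, integral_add (hφa.const_mul _) (hφ'.const_mul _), integral_const_mul,
      integral_const_mul, hodd, integral_complex_ofReal]
    ring
  rw [hnum, hden, Complex.ofReal_mul]
  exact mul_div_cancel_left₀ _
    (mul_ne_zero (Complex.ofReal_ne_zero.2 hc) (Complex.ofReal_ne_zero.2 hφ0))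

end Gaussian

/-! ### Ridge regression and the Gaussian posterior mean -/

section Ridge

variable {ι κ : Type*} [Fintype ι] [Fintype κ]

theorem sum_norm_sq_add (x y : ι → ℂ) :
    ∑ j, ‖x j + y j‖ ^ 2 = ∑ j, ‖x j‖ ^ 2 + 2 * (star x ⬝ᵥ y).re + ∑ j, ‖y j‖ ^ 2 := by
  simp only [dotProduct, Complex.re_sum, Finset.mul_sum, ← Finset.sum_add_distrib]
  refine Finset.sum_congr rfl fun j _ => ?_
  simp only [← Complex.normSq_eq_norm_sq, Complex.normSq_add, Pi.star_apply, RCLike.star_def]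
  have : (x j * (starRingEnd ℂ) (y j)).re = ((starRingEnd ℂ) (x j) * y j).re := by
    simp
  rw [this]
  ring

theorem star_mulVec_dotProduct (K : Matrix ι κ ℂ) (u : κ → ℂ) (w : ι → ℂ) :
    star (K.mulVec u) ⬝ᵥ w = star u ⬝ᵥ K.conjTranspose.mulVec w := by
  rw [Matrix.star_mulVec, Matrix.dotProduct_mulVec]

theorem re_star_dotProduct_le (x y : ι → ℂ) :
    (star x ⬝ᵥ y).re ≤ (∑ j, ‖x j‖ ^ 2 + ∑ j, ‖y j‖ ^ 2) / 2 := by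
  have h := sum_norm_sq_add x (-y)
  have h0 : 0 ≤ ∑ j, ‖x j + (-y) j‖ ^ 2 := Finset.sum_nonneg fun j _ => by positivity
  simp only [dotProduct_neg, Complex.neg_re, Pi.neg_apply, norm_neg] at h h0
  linarith

/-- The normal equations of ridge regression are solvable. -/
theorem exists_ridge_solution (K : Matrix ι κ ℂ) {s : ℝ} (hs : 0 < s) (y : ι → ℂ) :
    ∃ g₀ : κ → ℂ, (s : ℂ) • g₀ + K.conjTranspose.mulVec (K.mulVec g₀) =
      K.conjTranspose.mulVec y := by
  let f : (κ → ℂ) →ₗ[ℂ] (κ → ℂ) :=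
    (s : ℂ) • LinearMap.id + K.conjTranspose.mulVecLin ∘ₗ K.mulVecLin
  have hf (u : κ → ℂ) : f u = (s : ℂ) • u + K.conjTranspose.mulVec (K.mulVec u) := rfl
  have hinj : Function.Injective f := by
    rw [← LinearMap.ker_eq_bot, LinearMap.ker_eq_bot']
    intro u hu
    -- Pairing a kernel vector with itself gives `s ‖u‖² + ‖K u‖² = 0`.
    have h := congrArg (fun w => (star u ⬝ᵥ w).re) (hf u ▸ hu)
    simp only [dotProduct_add, dotProduct_smul, ← star_mulVec_dotProduct, dotProduct_zero,
      Complex.add_re, smul_eq_mul, Complex.re_ofReal_mul, ← sum_norm_sq_eq_re,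
      Complex.zero_re] at h
    have h1 : 0 ≤ ∑ j, ‖K.mulVec u j‖ ^ 2 := Finset.sum_nonneg fun j _ => by positivity
    have h2 : 0 ≤ ∑ j, ‖u j‖ ^ 2 := Finset.sum_nonneg fun j _ => by positivity
    have h3 : ∑ j, ‖u j‖ ^ 2 = 0 := by nlinarith
    funext j
    have := (Finset.sum_eq_zero_iff_of_nonneg fun j _ => by positivity).1 h3 j (Finset.mem_univ j)
    simpa using this
  obtain ⟨g₀, hg₀⟩ := (LinearMap.injective_iff_surjective.1 hinj) (K.conjTranspose.mulVec y)
  exact ⟨g₀, by rw [← hf, hg₀]⟩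

/-- Completing the square at a solution of the normal equations. -/
theorem sum_norm_sq_sub_mulVec_add (K : Matrix ι κ ℂ) {s : ℝ} {y : ι → ℂ} {g₀ : κ → ℂ}
    (h : (s : ℂ) • g₀ + K.conjTranspose.mulVec (K.mulVec g₀) = K.conjTranspose.mulVec y)
    (g : κ → ℂ) :
    ∑ j, ‖y j - K.mulVec g j‖ ^ 2 + s * ∑ j, ‖g j‖ ^ 2 =
      (∑ j, ‖y j - K.mulVec g₀ j‖ ^ 2 + s * ∑ j, ‖g₀ j‖ ^ 2) +
        (∑ j, ‖K.mulVec (g - g₀) j‖ ^ 2 + s * ∑ j, ‖(g - g₀) j‖ ^ 2) := by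
  obtain ⟨u, rfl⟩ : ∃ u, g = u + g₀ := ⟨g - g₀, by simp⟩
  -- With this form of the normal equations the cross terms of the two squares, `∓ 2 s Re ⟨u, g₀⟩`,
  -- cancel.
  have hr : K.conjTranspose.mulVec (y - K.mulVec g₀) = (s : ℂ) • g₀ := by
    rw [Matrix.mulVec_sub, ← h]; simp
  have h1 := sum_norm_sq_add (K.mulVec (-u)) (y - K.mulVec g₀)
  have h2 := sum_norm_sq_add u g₀
  rw [star_mulVec_dotProduct, hr] at h1
  simp only [Matrix.mulVec_neg, Pi.neg_apply, norm_neg, star_neg, neg_dotProduct, dotProduct_smul,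
    Complex.neg_re, smul_eq_mul, Complex.re_ofReal_mul, Pi.sub_apply] at h1
  have h3 : ∑ j, ‖y j - K.mulVec (u + g₀) j‖ ^ 2 =
      ∑ j, ‖-K.mulVec u j + (y j - K.mulVec g₀ j)‖ ^ 2 := by
    refine Finset.sum_congr rfl fun j _ => ?_
    rw [Matrix.mulVec_add, Pi.add_apply]
    congr 2
    ring
  rw [add_sub_cancel_right, h3, h1]
  simp only [Pi.add_apply]
  rw [h2]
  ring

/-- The posterior mean in the linear Gaussian model is the ridge regression estimate. -/
theorem gaussian_posterior_mean (K : Matrix ι κ ℂ) {s : ℝ} (hs : 0 < s) {y : ι → ℂ} {g₀ : κ → ℂ}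
    (h : (s : ℂ) • g₀ + K.conjTranspose.mulVec (K.mulVec g₀) = K.conjTranspose.mulVec y)
    {f : (κ → ℂ) → ℝ} {c : ℝ} (hc : c ≠ 0)
    (hf : ∀ g, f g = c * Real.exp (-(∑ j, ‖y j - K.mulVec g j‖ ^ 2 + s * ∑ j, ‖g j‖ ^ 2)))
    (a : κ) :
    (∫ g, (f g : ℂ) * g a) / ((∫ g, f g : ℝ) : ℂ) = g₀ a := by
  let φ : (κ → ℂ) → ℝ := fun u =>
    Real.exp (-(∑ j, ‖K.mulVec u j‖ ^ 2 + s * ∑ j, ‖u j‖ ^ 2))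
  have hcont : Continuous φ := by
    have : Continuous fun u : κ → ℂ => K.mulVec u := K.mulVecLin.continuous_of_finiteDimensional
    have h' (j : ι) : Continuous fun u : κ → ℂ => K.mulVec u j := (continuous_apply j).comp this
    fun_prop
  have hle (u : κ → ℂ) : φ u ≤ Real.exp (-(s * ∑ j, ‖u j‖ ^ 2)) := by
    refine Real.exp_le_exp.2 ?_
    have h1 : 0 ≤ ∑ j, ‖K.mulVec u j‖ ^ 2 := Finset.sum_nonneg fun j _ => by positivity
    linarith
  have hpos (u : κ → ℂ) : 0 < φ u := Real.exp_pos _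
  have hint : Integrable φ :=
    (integrable_exp_neg_mul_sum_norm_sq hs).mono' hcont.aestronglyMeasurable
      (Filter.Eventually.of_forall fun u => by
        rw [Real.norm_of_nonneg (hpos u).le]; exact hle u)
  have hinta : Integrable fun u : κ → ℂ => (φ u : ℂ) * u a := by
    refine (integrable_mul_exp_neg_mul_sum_norm_sq hs a).mono'
      (Continuous.aestronglyMeasurable (by fun_prop)) (Filter.Eventually.of_forall fun u => ?_)
    rw [norm_mul, Complex.norm_real, Real.norm_of_nonneg (hpos u).le, mul_comm]
    gcongr
    exact hle u
  -- After completing the square, the density is a constant times the even function `φ` of `g - g₀`.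
  refine integral_mul_div_integral_of_even (φ := φ)
    (c := c * Real.exp (-(∑ j, ‖y j - K.mulVec g₀ j‖ ^ 2 + s * ∑ j, ‖g₀ j‖ ^ 2)))
    (fun u => ?_) hint a hinta ?_ (mul_ne_zero hc (Real.exp_pos _).ne') fun g => ?_
  · simp [φ, Matrix.mulVec_neg]
  · refine (integral_pos_of_integrable_nonneg_nonzero (x := 0) hcont hint
      (fun u => (hpos u).le) (hpos 0).ne').ne'
  · rw [hf, sum_norm_sq_sub_mulVec_add K h g, neg_add, Real.exp_add, mul_assoc]

/-- An injective matrix is bounded below. -/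
theorem exists_pos_mul_sum_norm_sq_le (K : Matrix ι κ ℂ)
    (hK : ∀ g : κ → ℂ, K.mulVec g = 0 → g = 0) :
    ∃ lam : ℝ, 0 < lam ∧ ∀ u : κ → ℂ, lam * ∑ j, ‖u j‖ ^ 2 ≤ ∑ i, ‖K.mulVec u i‖ ^ 2 := by
  obtain ⟨c, hc, hlip⟩ := K.mulVecLin.exists_antilipschitzWith (LinearMap.ker_eq_bot'.2 hK)
  have hc' : (0 : ℝ) < c := hc
  -- The factor `c` is the antilipschitz constant in the sup norm, and the cardinality passes to
  -- sums of squares; the `+ 1` keeps the inverted constant positive when `κ` is empty.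
  refine ⟨((Fintype.card κ + 1) * c ^ 2)⁻¹, by positivity, fun u => ?_⟩
  have h1 : ‖u‖ ≤ c * ‖K.mulVec u‖ := by
    simpa using hlip.le_mul_dist u 0
  have h2 : ∑ j, ‖u j‖ ^ 2 ≤ (Fintype.card κ + 1) * ‖u‖ ^ 2 := by
    calc ∑ j, ‖u j‖ ^ 2 ≤ ∑ _j : κ, ‖u‖ ^ 2 :=
          Finset.sum_le_sum fun j _ => by gcongr; exact norm_le_pi_norm u j
      _ = Fintype.card κ * ‖u‖ ^ 2 := by simp
      _ ≤ _ := by gcongr; linarith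
  have h3 : ‖K.mulVec u‖ ^ 2 ≤ ∑ i, ‖K.mulVec u i‖ ^ 2 := by
    have h0 : 0 ≤ ∑ i, ‖K.mulVec u i‖ ^ 2 := Finset.sum_nonneg fun j _ => by positivity
    have : ‖K.mulVec u‖ ≤ Real.sqrt (∑ i, ‖K.mulVec u i‖ ^ 2) := by
      refine (pi_norm_le_iff_of_nonneg (Real.sqrt_nonneg _)).2 fun i => Real.le_sqrt_of_sq_le ?_
      exact Finset.single_le_sum (f := fun i => ‖K.mulVec u i‖ ^ 2)
        (fun j _ => by positivity) (Finset.mem_univ i)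
    calc _ ≤ Real.sqrt (∑ i, ‖K.mulVec u i‖ ^ 2) ^ 2 := by gcongr
      _ = _ := Real.sq_sqrt h0
  rw [inv_mul_le_iff₀ (by positivity)]
  calc ∑ j, ‖u j‖ ^ 2 ≤ (Fintype.card κ + 1) * ‖u‖ ^ 2 := h2
    _ ≤ (Fintype.card κ + 1) * (c * ‖K.mulVec u‖) ^ 2 := by gcongr
    _ = (Fintype.card κ + 1) * c ^ 2 * ‖K.mulVec u‖ ^ 2 := by ring
    _ ≤ _ := by gcongr

/-- The error of the ridge regression estimate from the noisy observation `√ρ K g + w`. -/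
theorem ridge_error_le (K : Matrix ι κ ℂ) {s ρ lam : ℝ} (hs : 0 < s) (hρ : 0 < ρ) (hlam : 0 < lam)
    (hK : ∀ u : κ → ℂ, lam * ∑ j, ‖u j‖ ^ 2 ≤ ∑ i, ‖K.mulVec u i‖ ^ 2)
    {g g₀ : κ → ℂ} {w : ι → ℂ}
    (h : (s : ℂ) • g₀ + (((Real.sqrt ρ : ℝ) : ℂ) • K).conjTranspose.mulVec
        ((((Real.sqrt ρ : ℝ) : ℂ) • K).mulVec g₀) =
      (((Real.sqrt ρ : ℝ) : ℂ) • K).conjTranspose.mulVec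
        ((((Real.sqrt ρ : ℝ) : ℂ) • K).mulVec g + w)) :
    ∑ j, ‖g j - g₀ j‖ ^ 2 ≤ lam⁻¹ * ρ⁻¹ * (s * ∑ j, ‖g j‖ ^ 2 + ∑ i, ‖w i‖ ^ 2) := by
  set Q : Matrix ι κ ℂ := ((Real.sqrt ρ : ℝ) : ℂ) • K
  obtain ⟨u, rfl⟩ : ∃ u, g = u + g₀ := ⟨g - g₀, by simp⟩
  have hQ : ∑ i, ‖Q.mulVec u i‖ ^ 2 = ρ * ∑ i, ‖K.mulVec u i‖ ^ 2 := by
    simp [Q, Matrix.smul_mulVec, mul_pow, Finset.mul_sum, Real.sq_sqrt hρ.le,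
      abs_of_nonneg (Real.sqrt_nonneg ρ)]
  -- The error `u = g - g₀` solves the normal equations with right-hand side `s g - Q* w`. Pairing
  -- with `u` and halving each cross term gives `s ‖u‖² + ‖Q u‖² ≤ s ‖g‖² + ‖w‖²`.
  have h1 : (s : ℂ) • u + Q.conjTranspose.mulVec (Q.mulVec u) =
      (s : ℂ) • (u + g₀) + Q.conjTranspose.mulVec (-w) := by
    rw [Matrix.mulVec_add, Matrix.mulVec_add, Matrix.mulVec_add] at h
    rw [Matrix.mulVec_neg, smul_add]
    linear_combination (exp := 1) -h
  have h2 := congrArg (fun v => (star u ⬝ᵥ v).re) h1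
  simp only [dotProduct_add, dotProduct_smul, ← star_mulVec_dotProduct, Complex.add_re,
    smul_eq_mul, Complex.re_ofReal_mul, ← sum_norm_sq_eq_re] at h2
  have h3 := re_star_dotProduct_le u (u + g₀)
  have h4 := re_star_dotProduct_le (Q.mulVec u) (-w)
  simp only [dotProduct_add, Complex.add_re, ← sum_norm_sq_eq_re, Pi.neg_apply, norm_neg] at h3 h4
  have h5 := hK u
  have h6 : 0 ≤ ∑ j, ‖u j‖ ^ 2 := Finset.sum_nonneg fun j _ => by positivity
  have h7 : ρ * (lam * ∑ j, ‖u j‖ ^ 2) ≤ s * ∑ j, ‖(u + g₀) j‖ ^ 2 + ∑ i, ‖w i‖ ^ 2 := by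
    have := mul_le_mul_of_nonneg_left h5 hρ.le
    have h8 := mul_le_mul_of_nonneg_left h3 hs.le
    nlinarith [mul_nonneg hs.le h6]
  have h9 : ∑ j, ‖(u + g₀) j - g₀ j‖ ^ 2 = ∑ j, ‖u j‖ ^ 2 := by simp
  rw [h9, ← mul_inv, le_inv_mul_iff₀ (by positivity)]
  linarith

end Ridge

/-! ### The tap law, zero padding and the pilot model -/

namespace SparseChannel

section Law

variable {ι : Type*} [Fintype ι]

theorem measurable_cnDensity (m : ι → ℂ) (s : ℝ) : Measurable (cnDensity m s) := by
  unfold cnDensity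
  fun_prop

theorem integrable_norm_sq_cnLaw {s : ℝ} (hs : 0 < s) (a : ι) :
    Integrable (fun x : ι → ℂ => ‖x a‖ ^ 2) (cnLaw 0 s) := by
  rw [cnLaw, integrable_withDensity_iff (measurable_cnDensity _ _).ennreal_ofReal
    (Filter.Eventually.of_forall fun x => ENNReal.ofReal_lt_top)]
  refine ((integrable_norm_sq_mul_exp_neg_mul_sum_norm_sq (inv_pos.2 hs) a).const_mul
    ((Real.pi * s) ^ Fintype.card ι)⁻¹).congr (Filter.Eventually.of_forall fun x => ?_)
  simp only
  rw [ENNReal.toReal_ofReal (by unfold cnDensity; positivity), cnDensity]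
  simp only [Pi.zero_apply, sub_zero, div_eq_inv_mul]
  ring

/-- The density is positive everywhere, so the nonempty open set `x a ≠ 0` is charged. -/
theorem not_ae_eq_zero_cnLaw {s : ℝ} (hs : 0 < s) (a : ι) :
    ¬ ∀ᵐ x ∂(cnLaw (0 : ι → ℂ) s), x a = 0 := by
  intro h
  rw [cnLaw, ae_withDensity_iff (measurable_cnDensity _ _).ennreal_ofReal] at h
  have hopen : IsOpen {x : ι → ℂ | x a ≠ 0} :=
    isOpen_ne.preimage (continuous_apply a)
  have hne : {x : ι → ℂ | x a ≠ 0}.Nonempty := ⟨fun _ => 1, by simp⟩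
  refine (hopen.measure_pos volume hne).ne' (measure_mono_null (fun x hx => ?_) (ae_iff.1 h))
  simp only [Set.mem_ofPred_eq, Classical.not_imp]
  refine ⟨?_, hx⟩
  rw [Ne, ENNReal.ofReal_eq_zero, not_le, cnDensity]
  positivity

end Law

section Extension

variable {N : ℕ}

/-- Zero padding of taps on the support `A` to length `N`. -/
def zeroPad (A : Finset (Fin N)) (g : A → ℂ) : Fin N → ℂ :=
  fun l => if h : l ∈ A then g ⟨l, h⟩ else 0

theorem submatrix_mulVec_eq_mulVec_zeroPad {κ : Type*} (M : Matrix (Fin N) (Fin N) ℂ)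
    (f : κ → Fin N) (A : Finset (Fin N)) (g : A → ℂ) (n : κ) :
    (M.submatrix f (fun a : A => (a : Fin N))).mulVec g n = M.mulVec (zeroPad A g) (f n) := by
  simp only [Matrix.mulVec, dotProduct, Matrix.submatrix_apply, zeroPad]
  rw [← Finset.sum_subset (Finset.subset_univ A), ← Finset.sum_coe_sort A]
  · exact Finset.sum_congr rfl fun a _ => by simp
  · intro l _ hl
    simp [hl]

theorem zeroPad_restrict {A : Finset (Fin N)} {h : Fin N → ℂ} (hA : ∀ l ∉ A, h l = 0) :
    zeroPad A (fun l : A => h l) = h := by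
  funext l
  by_cases hl : l ∈ A
  · simp [zeroPad, hl]
  · simp [zeroPad, hl, hA l hl]

theorem sum_norm_sq_sub_zeroPad {A : Finset (Fin N)} {h : Fin N → ℂ} (hA : ∀ l ∉ A, h l = 0)
    (g : A → ℂ) : ∑ l, ‖h l - zeroPad A g l‖ ^ 2 = ∑ l : A, ‖h l - g l‖ ^ 2 := by
  rw [← Finset.sum_subset (Finset.subset_univ A), ← Finset.sum_coe_sort A]
  · exact Finset.sum_congr rfl fun a _ => by simp [zeroPad]
  · intro l _ hl
    simp [hl, zeroPad, hA l hl]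

end Extension

/-- The matrix taking taps on the support `A` to the noiseless pilot observations at unit SNR. -/
noncomputable def pilotMatrix {N : ℕ} (Np : Finset (Fin N)) (x : Np → ℂ) (A : Finset (Fin N)) :
    Matrix Np A ℂ :=
  Matrix.of fun n a => ((Real.sqrt N : ℝ) : ℂ) * x n * dft N n a

section Pilot

variable {N : ℕ} (Np : Finset (Fin N)) (x : Np → ℂ) (A : Finset (Fin N))

theorem pilotMatrix_mulVec (g : A → ℂ) (n : Np) :
    (pilotMatrix Np x A).mulVec g n = ((Real.sqrt N : ℝ) : ℂ) * x n *
      ((dft N).submatrix (fun i : Np => (i : Fin N)) (fun a : A => (a : Fin N))).mulVec g n := by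
  simp only [pilotMatrix, Matrix.mulVec, dotProduct, Matrix.of_apply, Matrix.submatrix_apply,
    Finset.mul_sum, mul_assoc]

theorem pilotMean_eq {ρ : ℝ} (hρ : 0 ≤ ρ) (g : A → ℂ) :
    pilotMean ρ Np x A g = (((Real.sqrt ρ : ℝ) : ℂ) • pilotMatrix Np x A).mulVec g := by
  funext n
  rw [Matrix.smul_mulVec, Pi.smul_apply, pilotMatrix_mulVec, pilotMean, Real.sqrt_mul hρ,
    smul_eq_mul]
  push_cast
  ring

theorem pilotMatrix_mulVec_injective (hN : N.Prime) (hx : ∀ n, ‖x n‖ = 1)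
    (hcard : A.card ≤ Np.card) (g : A → ℂ) (hg : (pilotMatrix Np x A).mulVec g = 0) : g = 0 := by
  refine dft_submatrix_mulVec_injective hN Np A hcard g (funext fun n => ?_)
  have h := congrFun hg n
  have h1 : x n ≠ 0 := norm_ne_zero_iff.1 (by rw [hx n]; exact one_ne_zero)
  have h2 : ((Real.sqrt N : ℝ) : ℂ) ≠ 0 :=
    Complex.ofReal_ne_zero.2 (Real.sqrt_ne_zero'.2 (Nat.cast_pos.2 hN.pos))
  rw [pilotMatrix_mulVec] at h
  exact (mul_eq_zero.1 h).resolve_left (mul_ne_zero h2 h1)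

/-- The prior variance `S⁻¹` puts `S ‖g‖²` into the exponent next to the unit-variance noise term,
so the ridge parameter is `S`. -/
theorem mmseTaps_eq {S : ℕ} (hS : 1 ≤ S) {ρ : ℝ} (hρ : 0 < ρ) {y : Np → ℂ} {g₀ : A → ℂ}
    (h : ((S : ℝ) : ℂ) • g₀ + (((Real.sqrt ρ : ℝ) : ℂ) • pilotMatrix Np x A).conjTranspose.mulVec
        ((((Real.sqrt ρ : ℝ) : ℂ) • pilotMatrix Np x A).mulVec g₀) =
      (((Real.sqrt ρ : ℝ) : ℂ) • pilotMatrix Np x A).conjTranspose.mulVec y) :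
    mmseTaps S ρ Np x A y = g₀ := by
  have hS' : (0 : ℝ) < S := Nat.cast_pos.2 hS
  funext a
  refine gaussian_posterior_mean _ hS' h
    (c := ((Real.pi * 1) ^ Fintype.card Np)⁻¹ * ((Real.pi * (S : ℝ)⁻¹) ^ Fintype.card A)⁻¹)
    (by positivity) (fun g => ?_) a
  rw [jointDensity, cnDensity, cnDensity, pilotMean_eq Np x A hρ.le, neg_add, Real.exp_add]
  simp only [Pi.zero_apply, sub_zero, div_one, div_inv_eq_mul]
  rw [mul_comm (S : ℝ)]
  ring

end Pilot

/-! ### Upper and lower bounds for the mean squared error -/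

namespace Block

variable {Ω : Type*} [MeasurableSpace Ω] {μ : Measure Ω} {N L S : ℕ} (B : Block μ N L S)

/-- Channel and estimate are both `√N F` applied to length-`N` tap vectors, so Parseval applies to
their difference, whatever the supports. -/
theorem sum_norm_sq_estError (ρ : ℝ) (Np : Finset (Fin N)) (x : Np → ℂ) (A : Finset (Fin N))
    (ω : Ω) : ∑ n, ‖B.estError ρ Np x A ω n‖ ^ 2 =
      N * ∑ l, ‖B.taps ω l - zeroPad A (mmseTaps S ρ Np x A (B.pilotObs ρ Np x ω)) l‖ ^ 2 := by
  have h (n : Fin N) : B.estError ρ Np x A ω n = ((Real.sqrt N : ℝ) : ℂ) *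
      (dft N).mulVec (B.taps ω - zeroPad A (mmseTaps S ρ Np x A (B.pilotObs ρ Np x ω))) n := by
    rw [estError, freqChannel, mmseFreqChannel, submatrix_mulVec_eq_mulVec_zeroPad,
      Matrix.mulVec_sub, Pi.sub_apply, mul_sub, id]
  simp only [h, norm_mul, mul_pow, ← Finset.mul_sum, sum_norm_sq_dft_mulVec, Complex.norm_real,
    Real.norm_of_nonneg (Real.sqrt_nonneg _), Real.sq_sqrt (Nat.cast_nonneg N), Pi.sub_apply]

theorem pilotObs_eq {ρ : ℝ} {ω : Ω} (Np : Finset (Fin N)) (x : Np → ℂ) {T : Finset (Fin N)}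
    (hω : B.support ω = T) :
    B.pilotObs ρ Np x ω =
      (((Real.sqrt ρ : ℝ) : ℂ) • pilotMatrix Np x T).mulVec (fun l : T => B.taps ω l) +
        fun n : Np => (dft N).mulVec (B.noise ω) n := by
  funext n
  rw [Pi.add_apply, Matrix.smul_mulVec, Pi.smul_apply, pilotMatrix_mulVec,
    submatrix_mulVec_eq_mulVec_zeroPad, zeroPad_restrict (hω ▸ B.taps_eq_zero ω), pilotObs,
    freqChannel, smul_eq_mul]
  ring

theorem sum_enorm_sq_estError (ρ : ℝ) (Np : Finset (Fin N)) (x : Np → ℂ) (A : Finset (Fin N))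
    (ω : Ω) : ∑ n, ‖B.estError ρ Np x A ω n‖ₑ ^ 2 =
      ENNReal.ofReal (∑ n, ‖B.estError ρ Np x A ω n‖ ^ 2) := by
  rw [ENNReal.ofReal_sum_of_nonneg fun n _ => by positivity]
  simp only [ENNReal.ofReal_pow (norm_nonneg _), ofReal_norm]

/-- Pathwise bound on the error of the estimate under the true support hypothesis. -/
theorem sum_norm_sq_estError_le (hS : 1 ≤ S) {Np : Finset (Fin N)} {x : Np → ℂ}
    {T : Finset (Fin N)} {lam : ℝ} (hlam : 0 < lam)
    (hK : ∀ u : T → ℂ, lam * ∑ j, ‖u j‖ ^ 2 ≤ ∑ i, ‖(pilotMatrix Np x T).mulVec u i‖ ^ 2)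
    {ρ : ℝ} (hρ : 0 < ρ) {ω : Ω} (hω : B.support ω = T) :
    ∑ n, ‖B.estError ρ Np x T ω n‖ ^ 2 ≤ N * lam⁻¹ * ρ⁻¹ *
      (S * ∑ l : T, ‖B.taps ω l‖ ^ 2 + ∑ n, ‖B.noise ω n‖ ^ 2) := by
  obtain ⟨g₀, hg₀⟩ := exists_ridge_solution (((Real.sqrt ρ : ℝ) : ℂ) • pilotMatrix Np x T)
    (s := S) (Nat.cast_pos.2 hS) (B.pilotObs ρ Np x ω)
  rw [sum_norm_sq_estError, mmseTaps_eq Np x T hS hρ hg₀,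
    sum_norm_sq_sub_zeroPad (hω ▸ B.taps_eq_zero ω)]
  rw [B.pilotObs_eq Np x hω] at hg₀
  have h1 := ridge_error_le (pilotMatrix Np x T) (Nat.cast_pos.2 hS) hρ hlam hK hg₀
  -- The pilot noise is a part of `F v`, whose norm is that of `v`.
  have h2 : ∑ i : Np, ‖(dft N).mulVec (B.noise ω) i‖ ^ 2 ≤ ∑ n, ‖B.noise ω n‖ ^ 2 := by
    rw [← sum_norm_sq_dft_mulVec, Finset.sum_coe_sort Np
      (fun i => ‖(dft N).mulVec (B.noise ω) i‖ ^ 2)]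
    exact Finset.sum_le_univ_sum_of_nonneg fun i => by positivity
  rw [mul_assoc, mul_assoc]
  refine mul_le_mul_of_nonneg_left ?_ (Nat.cast_nonneg N)
  rw [← mul_assoc]
  refine h1.trans ?_
  gcongr

theorem integrable_taps_noise (hS : 1 ≤ S) {T : Finset (Fin N)}
    (hT : μ {ω | B.support ω = T} ≠ 0) :
    Integrable (fun ω => S * ∑ l : T, ‖B.taps ω l‖ ^ 2 + ∑ n, ‖B.noise ω n‖ ^ 2)
      (ProbabilityTheory.cond μ {ω | B.support ω = T}) := by
  have hmeas : Measurable fun ω (l : T) => B.taps ω l :=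
    measurable_pi_lambda _ fun l => (measurable_pi_apply _).comp B.measurable_taps
  refine ((integrable_finsetSum _ fun l _ => ?_).const_mul _).add
    (integrable_finsetSum _ fun n _ => ?_)
  · have h := integrable_norm_sq_cnLaw (inv_pos.2 (Nat.cast_pos.2 hS : (0 : ℝ) < S)) l
    rw [← B.law_taps T hT] at h
    exact h.comp_measurable hmeas
  · have h := integrable_norm_sq_cnLaw one_pos n
    rw [← B.law_noise T hT] at h
    exact h.comp_measurable B.measurable_noise

theorem exists_meanSqError_le (hN : N.Prime) (hS : 1 ≤ S) {Np : Finset (Fin N)}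
    (hP : S ≤ Np.card) {x : Np → ℂ} (hx : ∀ n, ‖x n‖ = 1) {T : Finset (Fin N)}
    (hTc : T.card = S) (hT : μ {ω | B.support ω = T} ≠ 0) :
    ∃ C : ℝ, ∀ ρ : ℝ, 0 < ρ → B.meanSqError ρ Np x T T ≤ ENNReal.ofReal (C * ρ⁻¹) := by
  obtain ⟨lam, hlam, hK⟩ := exists_pos_mul_sum_norm_sq_le (pilotMatrix Np x T)
    (pilotMatrix_mulVec_injective Np x T hN hx (hTc.trans_le hP))
  -- Neither `lam` nor `D` involves `ρ`, so both may enter the constant.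
  set D := ∫⁻ ω, ENNReal.ofReal (S * ∑ l : T, ‖B.taps ω l‖ ^ 2 + ∑ n, ‖B.noise ω n‖ ^ 2)
    ∂(ProbabilityTheory.cond μ {ω | B.support ω = T}) with hD
  have hDtop : D ≠ ⊤ := (B.integrable_taps_noise hS hT).lintegral_lt_top.ne
  refine ⟨N * lam⁻¹ * D.toReal, fun ρ hρ => ?_⟩
  calc B.meanSqError ρ Np x T T
      ≤ ∫⁻ ω, ENNReal.ofReal (N * lam⁻¹ * ρ⁻¹) *
          ENNReal.ofReal (S * ∑ l : T, ‖B.taps ω l‖ ^ 2 + ∑ n, ‖B.noise ω n‖ ^ 2)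
          ∂(ProbabilityTheory.cond μ {ω | B.support ω = T}) := by
        refine lintegral_mono_ae ?_
        filter_upwards [ae_cond_mem (B.measurableSet_support T)] with ω hω
        rw [sum_enorm_sq_estError, ← ENNReal.ofReal_mul (by positivity)]
        exact ENNReal.ofReal_le_ofReal (B.sum_norm_sq_estError_le hS hlam hK hρ hω)
    _ = ENNReal.ofReal (N * lam⁻¹ * ρ⁻¹) * D :=
        lintegral_const_mul' _ _ ENNReal.ofReal_ne_top
    _ = ENNReal.ofReal (N * lam⁻¹ * D.toReal * ρ⁻¹) := by
        nth_rw 1 [← ENNReal.ofReal_toReal hDtop]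
        rw [← ENNReal.ofReal_mul (by positivity)]
        congr 1
        ring

/-- A tap outside the hypothesized support contributes fully to the error. -/
theorem lintegral_tap_le_meanSqError (hN : N ≠ 0) (ρ : ℝ) (Np : Finset (Fin N)) (x : Np → ℂ)
    {A : Finset (Fin N)} (T : Finset (Fin N)) {l : Fin N} (hl : l ∉ A) :
    ∫⁻ ω, ENNReal.ofReal (‖B.taps ω l‖ ^ 2)
      ∂(ProbabilityTheory.cond μ {ω | B.support ω = T}) ≤ B.meanSqError ρ Np x A T := by
  refine lintegral_mono fun ω => ?_
  rw [sum_enorm_sq_estError, sum_norm_sq_estError]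
  refine ENNReal.ofReal_le_ofReal ?_
  have h1 : ‖B.taps ω l‖ ^ 2 ≤
      ∑ l, ‖B.taps ω l - zeroPad A (mmseTaps S ρ Np x A (B.pilotObs ρ Np x ω)) l‖ ^ 2 := by
    refine le_trans (le_of_eq ?_) (Finset.single_le_sum (f := fun l =>
      ‖B.taps ω l - zeroPad A (mmseTaps S ρ Np x A (B.pilotObs ρ Np x ω)) l‖ ^ 2)
      (fun j _ => by positivity) (Finset.mem_univ l))
    simp [zeroPad, hl]
  have h2 : (1 : ℝ) ≤ N := Nat.one_le_cast.2 (Nat.one_le_iff_ne_zero.2 hN)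
  exact h1.trans (le_mul_of_one_le_left (Finset.sum_nonneg fun j _ => by positivity) h2)

theorem lintegral_tap_ne_zero (hS : 1 ≤ S) {T : Finset (Fin N)}
    (hT : μ {ω | B.support ω = T} ≠ 0) {l : Fin N} (hl : l ∈ T) :
    ∫⁻ ω, ENNReal.ofReal (‖B.taps ω l‖ ^ 2)
      ∂(ProbabilityTheory.cond μ {ω | B.support ω = T}) ≠ 0 := by
  have hmeas : Measurable fun ω (l : T) => B.taps ω l :=
    measurable_pi_lambda _ fun l => (measurable_pi_apply _).comp B.measurable_taps
  have hl' : Measurable fun ω => B.taps ω l := (measurable_pi_apply _).comp B.measurable_taps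
  intro h
  rw [lintegral_eq_zero_iff (by fun_prop)] at h
  refine not_ae_eq_zero_cnLaw (inv_pos.2 (Nat.cast_pos.2 hS : (0 : ℝ) < S)) (⟨l, hl⟩ : T) ?_
  rw [← B.law_taps T hT]
  refine (ae_map_iff hmeas.aemeasurable
    (measurableSet_eq_fun (measurable_pi_apply _) measurable_const)).2 ?_
  filter_upwards [h] with ω hω
  have h0 : ‖B.taps ω l‖ ^ 2 ≤ 0 := ENNReal.ofReal_eq_zero.1 hω
  have h1 := le_antisymm h0 (by positivity)
  simpa using h1

end Block

end SparseChannel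

/-! ### The equivalence -/

theorem lemma2 {Ω : Type*} [MeasurableSpace Ω] (μ : Measure Ω) [IsProbabilityMeasure μ]
    (N L S : ℕ) (hN : N.Prime) (hS : 1 ≤ S) (hSL : S ≤ L) (hLN : L < N)
    (B : SparseChannel.Block μ N L S)
    (Np : Finset (Fin N)) (hP : S ≤ Np.card)
    (x : Np → ℂ) (hx : ∀ n, ‖x n‖ = 1)
    (A : Finset (Fin N)) (hA : SparseChannel.IsSupport L S A)
    (T : Finset (Fin N)) (hT : μ {ω | B.support ω = T} ≠ 0) :
    (∃ C : ℝ, ∀ ρ : ℝ, 0 < ρ →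
      B.meanSqError ρ Np x A T ≤ ENNReal.ofReal (C * ρ⁻¹)) ↔ A = T := by
  have hTc : T.card = S := by
    obtain ⟨ω, hω⟩ := nonempty_of_measure_ne_zero hT
    exact hω ▸ (B.isSupport ω).1
  refine ⟨fun ⟨C, hC⟩ => ?_, ?_⟩
  swap
  · rintro rfl
    exact B.exists_meanSqError_le hN hS hP hx hTc hT
  by_contra hAT
  obtain ⟨l, hlT, hlA⟩ : ∃ l ∈ T, l ∉ A := by
    by_contra! h
    exact hAT (Finset.eq_of_subset_of_card_le h (by rw [hA.1, hTc])).symm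
  -- The second moment of the missed tap does not depend on `ρ` but is bounded by `C / ρ` for every
  -- `ρ > 0`, so it would be zero.
  refine B.lintegral_tap_ne_zero hS hT hlT (le_antisymm ?_ bot_le)
  have hlim : Filter.Tendsto (fun ρ : ℝ => ENNReal.ofReal (C * ρ⁻¹)) Filter.atTop (nhds 0) := by
    have h := ENNReal.tendsto_ofReal ((tendsto_inv_atTop_zero (𝕜 := ℝ)).const_mul C)
    simpa using h
  refine ge_of_tendsto hlim ?_
  filter_upwards [Filter.eventually_gt_atTop 0] with ρ hρ
  exact (B.lintegral_tap_le_meanSqError hN.ne_zero ρ Np x T hlA).trans (hC ρ hρ)
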